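/- Let $\Gamma$ be a one-ended hyperbolic group acting simplicially on a simplicial tree $\Sigma$, and write $\Gamma(v)$ for the stabilizer of a vertex $v$. Call a subgroup $H\le\Gamma$ elementary if it is virtually cyclic, and full if it equals its commensurator $\{g\in\Gamma : [H:H\cap gHg^{-1}]<\infty \text{ and } [gHg^{-1}:H\cap gHg^{-1}]<\infty\}$. Suppose that $\Sigma$ is bipartite on $(V_{\mathrm e},V_{\mathrm{ne}})$, where $V_{\mathrm e}$ is the set of vertices with elementary stabilizer and $V_{\mathrm{ne}}$ is the set of vertices with nonelementary stabilizer, and that every vertex stabilizer is full. Then there are a tree $\Sigma'$, a simplicial action of $\Gamma$ on $\Sigma'$, and a $\Gamma$-equivariant graph map $f:\Sigma\to\Sigma'$, surjective on vertices and on edges, such that: (a) for vertices $u,v$ of $\Sigma$, $f(u)=f(v)$ if and only if $\Gamma(u)=\Gamma(v)$; (b) for $u\in V_{\mathrm e}$ and $v\in V_{\mathrm{ne}}$, $f(u)$ and $f(v)$ are adjacent in $\Sigma'$ if and only if $\Gamma(u)\cap\Gamma(v)$ is infinite; (c) distinct vertices of $\Sigma'$ have distinct stabilizers; (d) $\Sigma'$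 is bipartite, its two classes being the set of vertices with elementary stabilizer and the set of vertices with nonelementary stabilizer; (e) $\Gamma(f(v))=\Gamma(v)$ for every vertex $v$ of $\Sigma$. -/

import Mathlib

universe u v

/-- `s` is (the image of) a geodesic segment from `x` to `y` in the metric space `X`. -/
def IsGeodesicSegment {X : Type*} [MetricSpace X] (x y : X) (s : Set X) : Prop :=
  ∃ γ : ℝ → X, γ 0 = x ∧ γ (dist x y) = y ∧
    (∀ a ∈ Set.Icc (0 : ℝ) (dist x y), ∀ b ∈ Set.Icc (0 : ℝ) (dist x y),
      dist (γ a) (γ b) = |a - b|) ∧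
    γ '' Set.Icc (0 : ℝ) (dist x y) = s

/-- A Gromov hyperbolic space: a geodesic space in which, for some `δ > 0`, every geodesic triangle
is `δ`-slim. -/
def IsHyperbolicSpace (X : Type*) [MetricSpace X] : Prop :=
  (∀ x y : X, ∃ s : Set X, IsGeodesicSegment x y s) ∧
  ∃ δ : ℝ, 0 < δ ∧ ∀ (x y z : X) (a b c : Set X),
    IsGeodesicSegment x y a → IsGeodesicSegment y z b → IsGeodesicSegment x z c →
      a ⊆ Metric.thickening δ (b ∪ c) ∧ b ⊆ Metric.thickening δ (a ∪ c) ∧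
      c ⊆ Metric.thickening δ (a ∪ b)

/-- An action is geometric if it is by isometries, properly discontinuous and cocompact. -/
def IsGeometricAction (G X : Type*) [Group G] [MetricSpace X] [MulAction G X] : Prop :=
  IsIsometricSMul G X ∧ ProperlyDiscontinuousSMul G X ∧
  ∃ K : Set X, IsCompact K ∧ ∀ x : X, ∃ g : G, ∃ k ∈ K, g • k = x

/-- A group is hyperbolic if it acts geometrically on a nonempty proper hyperbolic space.
(A proper metric space has at most continuum many points, so spaces in `Type` suffice.) -/
def IsHyperbolicGroup (G : Type*) [Group G] : Prop :=
  ∃ (X : Type) (_ : MetricSpace X) (_ : MulAction G X),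
    Nonempty X ∧ ProperSpace X ∧ IsHyperbolicSpace X ∧ IsGeometricAction G X

/-- A finitely generated group is one-ended if its Cayley graph with respect to a finite generating
set has exactly one end. -/
def IsOneEndedGroup (G : Type*) [Group G] : Prop :=
  ∃ S : Finset G, Subgroup.closure (S : Set G) = ⊤ ∧
    Nat.card (SimpleGraph.mulCayley (S : Set G)).end = 1

/-- A subgroup is elementary if it is virtually cyclic, i.e. finite or virtually infinite cyclic. -/
def IsElementary {G : Type*} [Group G] (H : Subgroup G) : Prop :=
  ∃ C : Subgroup H, IsCyclic C ∧ C.FiniteIndex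

/-- A subgroup is full if it is equal to its commensurator. -/
def IsFull {G : Type*} [Group G] (H : Subgroup G) : Prop :=
  Subgroup.Commensurable.commensurator H = H

/-- The vertices with elementary stabilizer. -/
def elementaryVertices (G V : Type*) [Group G] [MulAction G V] : Set V :=
  {v | IsElementary (MulAction.stabilizer G v)}

/-- The vertices with nonelementary stabilizer. -/
def nonelementaryVertices (G V : Type*) [Group G] [MulAction G V] : Set V :=
  {v | ¬ IsElementary (MulAction.stabilizer G v)}

/-- The action of `G` on the vertices of `T` is simplicial. -/
def IsSimplicialAction (G : Type*) {V : Type*} [Group G] [MulAction G V]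
    (T : SimpleGraph V) : Prop :=
  ∀ (g : G) (u v : V), T.Adj u v → T.Adj (g • u) (g • v)

/-- Distinct vertices have distinct stabilizers. -/
def HasDistinctStabilizers (G V : Type*) [Group G] [MulAction G V] : Prop :=
  ∀ u v : V, u ≠ v → MulAction.stabilizer G u ≠ MulAction.stabilizer G v

/-- `T` is bipartite, its two classes being the vertices with elementary stabilizer and the vertices
with nonelementary stabilizer. -/
def IsElementaryBipartite (G : Type*) {V : Type*} [Group G] [MulAction G V]
    (T : SimpleGraph V) : Prop :=
  T.IsBipartiteWith (elementaryVertices G V) (nonelementaryVertices G V)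

open scoped Pointwise

/-! The tree `Σ'` is the quotient of `Σ` by equality of stabilizers. A full subgroup of an infinite
group is infinite, and one-endedness then makes edge stabilizers infinite too
(`IsOneEndedGroup.infinite_inf_stabilizer`). Full elementary subgroups with infinite intersection
are commensurable, hence equal (`IsElementary.eq_of_infinite_inf`).

Nonelementary vertices are determined by their stabilizers, so only elementary vertices get
identified. The quotient is connected; it is acyclic because each of its edges is a bridge
(`IsElementaryBipartite.isBridge_graph`). Fullness also keeps the stabilizer of a class from
exceeding that of its members (`StabilizerQuotient.stabilizer_mk`). -/

/-! ### Elementary and full subgroups. -/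

theorem Subgroup.relIndex_zpowers_ne_zero {G : Type*} [Group G] {K : Subgroup G} {z : G} {n : ℤ}
    (hn : n ≠ 0) (hz : z ^ n ∈ K) : K.relIndex (Subgroup.zpowers z) ≠ 0 := by
  -- Pull back along `k ↦ z ^ k`: the preimage of `K` in `ℤ` contains `nℤ`, of index `|n|`.
  have hr : Subgroup.zpowers z = (⊤ : Subgroup (Multiplicative ℤ)).map (zpowersHom G z) := by
    ext x
    simp only [Subgroup.mem_zpowers_iff, Subgroup.mem_map, Subgroup.mem_top, true_and]
    exact ⟨fun ⟨k, hk⟩ => ⟨Multiplicative.ofAdd k, hk⟩, fun ⟨k, hk⟩ => ⟨k.toAdd, hk⟩⟩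
  rw [hr, ← Subgroup.relIndex_comap, Subgroup.relIndex_top_right]
  have hle : AddSubgroup.toSubgroup (AddSubgroup.zmultiples n) ≤ K.comap (zpowersHom G z) := by
    intro x hx
    obtain ⟨k, hk⟩ := AddSubgroup.mem_zmultiples_iff.1 (show x.toAdd ∈ _ from hx)
    simp only [Subgroup.mem_comap, zpowersHom_apply, ← hk, smul_eq_mul, mul_comm k, zpow_mul]
    exact K.zpow_mem hz k
  have hi : (AddSubgroup.toSubgroup (AddSubgroup.zmultiples n)).index ≠ 0 := by
    rw [AddSubgroup.index_toSubgroup, Int.index_zmultiples]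
    exact Int.natAbs_ne_zero.2 hn
  exact fun h => hi (Nat.eq_zero_of_zero_dvd (h ▸ Subgroup.index_dvd_of_le hle))

namespace IsElementary

variable {G : Type*} [Group G] {H K : Subgroup G}

theorem iff_exists_zpowers :
    IsElementary H ↔ ∃ z ∈ H, (Subgroup.zpowers z).relIndex H ≠ 0 := by
  constructor
  · rintro ⟨C, hC, hF⟩
    obtain ⟨z, rfl⟩ := (Subgroup.isCyclic_iff_exists_zpowers_eq_top C).1 hC
    refine ⟨z, z.2, ?_⟩
    have : (Subgroup.zpowers (z : G)).subgroupOf H = Subgroup.zpowers z := by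
      ext x
      simp [Subgroup.mem_subgroupOf, Subgroup.mem_zpowers_iff, Subtype.ext_iff]
    rw [Subgroup.relIndex, this]
    exact hF.index_ne_zero
  · rintro ⟨z, hz, h⟩
    have : (Subgroup.zpowers (z : G)).subgroupOf H = Subgroup.zpowers ⟨z, hz⟩ := by
      ext x
      simp [Subgroup.mem_subgroupOf, Subgroup.mem_zpowers_iff, Subtype.ext_iff]
    rw [Subgroup.relIndex, this] at h
    exact ⟨_, inferInstance, ⟨h⟩⟩

/-- An infinite subgroup of an elementary group has finite index. -/
theorem relIndex_ne_zero (hH : IsElementary H) (hKH : K ≤ H) (hK : (K : Set G).Infinite) :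
    K.relIndex H ≠ 0 := by
  obtain ⟨z, hz, h⟩ := iff_exists_zpowers.1 hH
  -- `⟨z⟩` meets `K` in a subgroup of finite index in `K`, so a trivial intersection would make `K`
  -- finite.
  have hne : Subgroup.zpowers z ⊓ K ≠ ⊥ := by
    intro hbot
    have h1 : (Subgroup.zpowers z).relIndex K ≠ 0 :=
      fun h0 => h (Subgroup.relIndex_eq_zero_of_le_right hKH h0)
    rw [← Subgroup.inf_relIndex_right, hbot, Subgroup.relIndex_bot_left] at h1
    exact hK (Nat.finite_of_card_ne_zero h1)
  obtain ⟨⟨k, hk⟩, hk1⟩ := Subgroup.ne_bot_iff_exists_ne_one.1 hne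
  obtain ⟨n, rfl⟩ := Subgroup.mem_zpowers_iff.1 hk.1
  refine Subgroup.relIndex_ne_zero_trans (Subgroup.relIndex_zpowers_ne_zero ?_ hk.2) h
  rintro rfl
  exact hk1 (Subtype.ext (zpow_zero z))

theorem of_finite (hH : (H : Set G).Finite) : IsElementary H := by
  have : Finite H := hH
  refine iff_exists_zpowers.2 ⟨1, H.one_mem, ?_⟩
  rw [Subgroup.zpowers_one_eq_bot, Subgroup.relIndex_bot_left]
  exact Nat.card_pos.ne'

theorem mono (hH : IsElementary H) (hKH : K ≤ H) : IsElementary K := by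
  by_cases hK : (K : Set G).Finite
  · exact of_finite hK
  obtain ⟨z, hz, h⟩ := iff_exists_zpowers.1 hH
  obtain ⟨n, hn, -, hzn⟩ := Subgroup.exists_pow_mem_of_relIndex_ne_zero
    (relIndex_ne_zero hH hKH hK) hz
  have h1 := Subgroup.relIndex_ne_zero_trans
    (Subgroup.relIndex_zpowers_ne_zero (K := Subgroup.zpowers (z ^ n)) (z := z) (n := n)
      (by exact_mod_cast hn.ne') (by simp)) h
  exact iff_exists_zpowers.2 ⟨z ^ n, hzn.1,
    fun h0 => h1 (Subgroup.relIndex_eq_zero_of_le_right hKH h0)⟩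

/-- Full elementary subgroups with infinite intersection are equal. -/
theorem eq_of_infinite_inf (hH : IsElementary H) (hK : IsElementary K) (fH : IsFull H)
    (fK : IsFull K) (h : ((H ⊓ K : Subgroup G) : Set G).Infinite) : H = K := by
  have hc : Subgroup.Commensurable H K := by
    constructor
    · rw [← Subgroup.inf_relIndex_right]
      exact hK.relIndex_ne_zero inf_le_right h
    · rw [← Subgroup.inf_relIndex_left]
      exact hH.relIndex_ne_zero inf_le_left h
  exact fH.symm.trans (hc.eq.trans fK)

end IsElementary

namespace IsFull

variable {G : Type*} [Group G] {H : Subgroup G}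

/-- A finite subgroup is commensurable with all its conjugates, so its commensurator is the whole
group. -/
theorem infinite [Infinite G] (fH : IsFull H) : (H : Set G).Infinite := by
  intro hf
  have hfin : ∀ K : Subgroup G, Finite K → ∀ L : Subgroup G, L.relIndex K ≠ 0 := fun K _ L =>
    Subgroup.FiniteIndex.index_ne_zero (H := L.subgroupOf K)
  have hfi : Finite H := hf
  have : H = ⊤ := by
    rw [← fH, eq_top_iff]
    intro g _
    have hfc : Finite ↑(ConjAct.toConjAct g • H) := hf.smul_set (a := ConjAct.toConjAct g)
    rw [Subgroup.Commensurable.commensurator_mem_iff]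
    exact ⟨hfin _ hfi _, hfin _ hfc _⟩
  subst this
  exact Set.infinite_univ hf

theorem mem_of_conj_eq (fH : IsFull H) {g : G} (hg : ConjAct.toConjAct g • H = H) : g ∈ H := by
  rw [← fH, Subgroup.Commensurable.commensurator_mem_iff, hg]

end IsFull

/-! ### Ends of graphs and one-ended groups. -/

namespace SimpleGraph

/-- An infinite component of the complement of a finite set contains an end. -/
theorem exists_end_of_infinite {V : Type*} {X : SimpleGraph V} (hlf : ∀ v, (X.neighborSet v).Finite)
    (hc : X.Preconnected) (K : Finset V) (C : X.ComponentCompl K) (hC : C.supp.Infinite) :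
    ∃ e : X.end, e.1 (.op K) = C := by
  classical
  have : X.LocallyFinite := fun v => (hlf v).fintype
  have : Fact X.Preconnected := ⟨hc⟩
  have hV : Infinite V := by
    by_contra h
    rw [not_infinite_iff_finite] at h
    exact hC (Set.toFinite _)
  let F := X.componentComplFunctor
  have hfin : ∀ j, Finite (F.obj j) := fun j => X.componentCompl_finite j.unop
  have hne : ∀ j, Nonempty (F.obj j) := fun j => X.componentCompl_nonempty_of_infinite j.unop
  have hML : F.IsMittagLeffler := F.isMittagLeffler_of_exists_finite_range
    fun j => ⟨j, CategoryTheory.CategoryStruct.id j, Set.toFinite _⟩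
  have hne' : ∀ j, Nonempty (F.toEventualRanges.obj j) := F.toEventualRanges_nonempty hML
  have hfin' : ∀ j, Finite (F.toEventualRanges.obj j) := fun j => Subtype.finite
  -- Infinite components are those in the eventual range. Transition maps between eventual ranges
  -- are surjective, and these sets are finite and nonempty, so any element extends to a section.
  obtain ⟨s, hs⟩ := F.toEventualRanges.eval_section_surjective_of_surjective
    (F.surjective_toEventualRanges hML) (.op K)
    ⟨C, (X.infinite_iff_in_eventualRange (K := .op K) C).1 hC⟩
  exact ⟨F.toEventualRangesSectionsEquiv s, congrArg Subtype.val hs⟩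

/-- A locally finite connected graph with an infinite, coinfinite set of vertices having
finite boundary does not have exactly one end. -/
theorem card_end_ne_one {V : Type*} {X : SimpleGraph V} (hlf : ∀ v, (X.neighborSet v).Finite)
    (hc : X.Preconnected) {A K : Set V} (hK : K.Finite)
    (hAK : ∀ ⦃x y⦄, X.Adj x y → x ∈ A → y ∉ A → x ∈ K) (hA : A.Infinite) (hA' : Aᶜ.Infinite) :
    Nat.card X.end ≠ 1 := by
  classical
  have : X.LocallyFinite := fun v => (hlf v).fintype
  have : Fact X.Preconnected := ⟨hc⟩
  lift K to Finset V using hK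
  -- Membership in `A` is constant on components of the complement of `K`, so `φ` separates an
  -- infinite component inside `A` from one outside.
  let φ : X.ComponentCompl K → Prop := ComponentCompl.lift (fun v _ => v ∈ A) (by
    intro v w hv hw h
    refine propext ⟨fun hvA => ?_, fun hwA => ?_⟩
    · by_contra hwA
      exact hv (hAK h hvA hwA)
    · by_contra hvA
      exact hw (hAK h.symm hwA hvA))
  -- Pigeonhole: finitely many components cover the complement of `K`.
  have key : ∀ B : Set V, B.Infinite → ∃ C : X.ComponentCompl K, C.supp.Infinite ∧
      ∃ v, ∃ hv : v ∉ K, v ∈ B ∧ X.componentComplMk hv = C := by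
    intro B hB
    have hinf : Infinite ↑(B \ (K : Set V)) := (hB.sdiff K.finite_toSet).to_subtype
    obtain ⟨C, hC⟩ := Finite.exists_infinite_fiber
      (fun x : ↑(B \ (K : Set V)) => X.componentComplMk (K := K) x.2.2)
    refine ⟨C, ?_, ?_⟩
    · have h2 := (Set.infinite_coe_iff.1 hC).image (Subtype.val_injective.injOn)
      refine h2.mono ?_
      rintro _ ⟨x, hx, rfl⟩
      exact ⟨x.2.2, hx⟩
    · obtain ⟨x, hx⟩ := (Set.infinite_coe_iff.1 hC).nonempty
      exact ⟨x, x.2.2, x.2.1, hx⟩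
  obtain ⟨C, hC, v, hv, hvA, rfl⟩ := key A hA
  obtain ⟨D, hD, w, hw, hwA, rfl⟩ := key Aᶜ hA'
  obtain ⟨e₁, h₁⟩ := exists_end_of_infinite hlf hc K _ hC
  obtain ⟨e₂, h₂⟩ := exists_end_of_infinite hlf hc K _ hD
  intro hcard
  have := (Nat.card_eq_one_iff_unique.1 hcard).1
  rw [Subsingleton.elim e₂ e₁, h₁] at h₂
  have : φ (X.componentComplMk hv) = φ (X.componentComplMk hw) := by rw [h₂]
  exact hwA ((show (v ∈ A) = (w ∈ A) from this) ▸ hvA)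

variable {G : Type*} [Group G]

theorem finite_neighborSet_mulCayley {S : Set G} (hS : S.Finite) (g : G) :
    ((mulCayley S).neighborSet g).Finite := by
  refine ((hS.image (g * ·)).union (hS.inv.image (g * ·))).subset fun h hh => ?_
  rw [mem_neighborSet, mulCayley_adj] at hh
  rcases hh.2 with h1 | h1
  · exact .inl ⟨_, h1, by simp⟩
  · exact .inr ⟨_, Set.mem_inv.2 (by simpa using h1), mul_inv_cancel_left g h⟩

theorem preconnected_mulCayley {S : Set G} (hS : Subgroup.closure S = ⊤) :
    (mulCayley S).Preconnected := by
  have key : ∀ s ∈ S, ∀ g : G, (mulCayley S).Reachable g (g * s) := by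
    intro s hs g
    by_cases h : g = g * s
    · rw [← h]
    · exact Adj.reachable ((mulCayley_adj _ _ _).2 ⟨h, .inl (by simpa using hs)⟩)
  have h1 : ∀ x : G, ∀ g : G, (mulCayley S).Reachable g (g * x) := by
    intro x
    have hx : x ∈ Subgroup.closure S := hS ▸ Subgroup.mem_top x
    induction hx using Subgroup.closure_induction with
    | mem s hs => exact key s hs
    | one => intro g; rw [mul_one]
    | mul a b _ _ ha hb => intro g; rw [← mul_assoc]; exact (ha g).trans (hb _)
    | inv a _ ha => intro g; simpa using (ha (g * a⁻¹)).symm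
  intro g h
  simpa using h1 (g⁻¹ * h) g

end SimpleGraph

theorem IsOneEndedGroup.infinite {G : Type*} [Group G] (hG : IsOneEndedGroup G) : Infinite G := by
  obtain ⟨S, -, h⟩ := hG
  by_contra hfin
  rw [not_infinite_iff_finite] at hfin
  obtain ⟨e⟩ := (Nat.card_eq_one_iff_unique.1 h).2
  have := Fintype.ofFinite G
  obtain ⟨v, hv⟩ := (e.1 (.op Finset.univ)).nonempty
  exact SimpleGraph.ComponentCompl.notMem_of_mem hv (Finset.mem_coe.2 (Finset.mem_univ v))

/-- Only finitely many edges of the Cayley graph leave such an almost invariant set `A`, so it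
cannot separate two ends. -/
theorem IsOneEndedGroup.finite_or_finite_compl {G : Type*} [Group G] (hG : IsOneEndedGroup G)
    {A : Set G} (hA : ∀ s : G, {g | g ∈ A ∧ g * s ∉ A}.Finite) : A.Finite ∨ Aᶜ.Finite := by
  by_contra! h
  obtain ⟨S, hS, hcard⟩ := hG
  refine SimpleGraph.card_end_ne_one (A := A)
    (K := ⋃ s ∈ (S : Set G) ∪ (S : Set G)⁻¹, {g | g ∈ A ∧ g * s ∉ A})
    (SimpleGraph.finite_neighborSet_mulCayley S.finite_toSet)
    (SimpleGraph.preconnected_mulCayley hS)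
    ((S.finite_toSet.union S.finite_toSet.inv).biUnion fun s _ => hA s) ?_ h.1 h.2 hcard
  intro x y hxy hx hy
  rw [SimpleGraph.mulCayley_adj] at hxy
  refine Set.mem_biUnion (x := x⁻¹ * y) ?_ ⟨hx, by simpa using hy⟩
  exact hxy.2.imp id fun h => by simpa using h

/-! ### Half-trees and simplicial actions on trees. -/

namespace SimpleGraph

variable {V : Type*} {T : SimpleGraph V} {u v w x y : V}

/-- The vertices that can be reached from `u` without crossing the edge from `u` to `v`. -/
def halfTree (T : SimpleGraph V) (u v : V) : Set V :=
  {w | (T.deleteEdges {s(u, v)}).Reachable u w}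

theorem mem_halfTree_self : u ∈ T.halfTree u v := Reachable.refl u

theorem IsTree.notMem_halfTree (hT : T.IsTree) (h : T.Adj u v) : v ∉ T.halfTree u v :=
  isBridge_iff.1 (isAcyclic_iff_forall_adj_isBridge.1 hT.isAcyclic h)

theorem mem_halfTree_of_adj (hx : x ∈ T.halfTree u v) (h : T.Adj x y) (he : s(x, y) ≠ s(u, v)) :
    y ∈ T.halfTree u v :=
  Reachable.trans hx (Adj.reachable (deleteEdges_adj.2 ⟨h, he⟩))

theorem mem_edges_of_mem_halfTree (hx : x ∈ T.halfTree u v) (hy : y ∉ T.halfTree u v)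
    (p : T.Walk x y) : s(u, v) ∈ p.edges := by
  by_contra h
  exact hy (Reachable.trans hx (reachable_deleteEdges_iff_exists_walk.2 ⟨p, h⟩))

/-- In a path from `u` to `w ≠ u`, the target lies beyond the first edge. -/
theorem Walk.IsPath.exists_mem_halfTree {p : T.Walk u w} (hp : p.IsPath) (h : u ≠ w) :
    ∃ x ∈ p.support, T.Adj u x ∧ w ∈ T.halfTree x u := by
  cases p with
  | nil => exact absurd rfl h
  | @cons _ x _ hux q =>
    rw [cons_isPath_iff] at hp
    refine ⟨x, by simp, hux, reachable_deleteEdges_iff_exists_walk.2 ⟨q, fun hq => ?_⟩⟩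
    exact hp.2 (q.snd_mem_support_of_mem_edges hq)

end SimpleGraph

open MulAction SimpleGraph

namespace IsSimplicialAction

variable {G : Type*} [Group G] {V : Type*} [MulAction G V] {T : SimpleGraph V}

/-- The graph homomorphism given by a group element. -/
def hom (hact : IsSimplicialAction G T) (g : G) : T →g T := ⟨(g • ·), hact g _ _⟩

/-- The translate of the path by `g` has the same endpoints, so by uniqueness of paths it is the
same path, traversed vertex by vertex. -/
theorem smul_eq_of_mem_support (hact : IsSimplicialAction G T) (hT : T.IsTree) {g : G} {u w x : V}
    (hu : g • u = u) (hw : g • w = w) {p : T.Walk u w} (hp : p.IsPath) (hx : x ∈ p.support) :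
    g • x = x := by
  have hinj : Function.Injective (hact.hom g) := MulAction.injective g
  replace hu : hact.hom g u = u := hu
  replace hw : hact.hom g w = w := hw
  have hq : ((p.map (hact.hom g)).copy hu hw).IsPath := by
    rw [Walk.isPath_copy]
    exact hp.map hinj
  have he := congrArg Walk.support
    (congrArg Subtype.val ((hT.isAcyclic.subsingleton_path u w).elim ⟨_, hq⟩ ⟨p, hp⟩))
  simp only [Walk.support_copy, Walk.support_map] at he
  have h2 : p.support.map (hact.hom g) = p.support.map id := by rw [he, List.map_id]
  exact List.map_inj_left.1 h2 x hx

theorem inf_stabilizer_le (hact : IsSimplicialAction G T) (hT : T.IsTree) {u w x : V}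
    {p : T.Walk u w} (hp : p.IsPath) (hx : x ∈ p.support) :
    stabilizer G u ⊓ stabilizer G w ≤ stabilizer G x :=
  fun _ hg => hact.smul_eq_of_mem_support hT hg.1 hg.2 hp hx

theorem inf_stabilizer_le_of_mem_halfTree (hact : IsSimplicialAction G T) (hT : T.IsTree)
    {u v x y : V} (hx : x ∈ T.halfTree u v) (hy : y ∉ T.halfTree u v) :
    stabilizer G x ⊓ stabilizer G y ≤ stabilizer G u := by
  obtain ⟨p, hp⟩ := (hT.existsUnique_path x y).exists
  exact hact.inf_stabilizer_le hT hp
    (p.fst_mem_support_of_mem_edges (mem_edges_of_mem_halfTree hx hy p))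

end IsSimplicialAction

/-! ### Edge stabilizers are infinite. -/

section Edge

variable {G : Type*} [Group G] {V : Type*} [MulAction G V] {T : SimpleGraph V}

theorem MulAction.finite_setOf_smul_eq_and_smul_eq {u v : V}
    (h : ((stabilizer G u ⊓ stabilizer G v : Subgroup G) : Set G).Finite) (a b : V) :
    {g : G | g • a = u ∧ g • b = v}.Finite := by
  rcases {g : G | g • a = u ∧ g • b = v}.eq_empty_or_nonempty with h0 | ⟨k, hk⟩
  · simp [h0]
  refine (h.image (· * k)).subset fun g hg => ⟨g * k⁻¹, ⟨?_, ?_⟩, by simp⟩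
  · change (g * k⁻¹) • u = u
    rw [← hk.1, smul_smul, inv_mul_cancel_right, hg.1, hk.1]
  · change (g * k⁻¹) • v = v
    rw [← hk.2, smul_smul, inv_mul_cancel_right, hg.2, hk.2]

/-- A one-ended group does not split nontrivially over a finite group: an edge joining vertices
with infinite stabilizers has infinite stabilizer. -/
theorem IsOneEndedGroup.infinite_inf_stabilizer (hG : IsOneEndedGroup G)
    (hact : IsSimplicialAction G T) (hT : T.IsTree) {u v : V} (h : T.Adj u v)
    (hu : (stabilizer G u : Set G).Infinite) (hv : (stabilizer G v : Set G).Infinite) :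
    ((stabilizer G u ⊓ stabilizer G v : Subgroup G) : Set G).Infinite := by
  intro hfin
  -- The set of `g` with `g • u` on the `u` side of the edge is almost invariant: if right
  -- multiplication by `s` leaves it, `g` carries one of the finitely many edges of a walk from `u`
  -- to `s • u` onto `s(u, v)`. Each edge allows finitely many such `g`, as the stabilizers of `u`
  -- and `v` meet in a finite group.
  have hbd : ∀ s : G, {g | g ∈ {g : G | g • u ∈ T.halfTree u v} ∧
      g * s ∉ {g : G | g • u ∈ T.halfTree u v}}.Finite := by
    intro s
    obtain ⟨p⟩ := hT.connected.preconnected u (s • u)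
    have hf : ∀ e : Sym2 V, {g : G | e.map (g • ·) = s(u, v)}.Finite := by
      refine Sym2.ind fun a b => ?_
      refine ((finite_setOf_smul_eq_and_smul_eq hfin a b).union
        (finite_setOf_smul_eq_and_smul_eq hfin b a)).subset fun g hg => ?_
      rw [Set.mem_ofPred_eq, Sym2.map_mk, Sym2.eq_iff] at hg
      exact hg.imp id fun h1 => ⟨h1.2, h1.1⟩
    refine (p.edges.finite_toSet.biUnion fun e _ => hf e).subset fun g hg => ?_
    have hx : hact.hom g u ∈ T.halfTree u v := hg.1
    have hy : hact.hom g (s • u) ∉ T.halfTree u v := by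
      change g • s • u ∉ _
      rw [smul_smul]
      exact hg.2
    have := mem_edges_of_mem_halfTree hx hy (p.map (hact.hom g))
    rw [Walk.edges_map, List.mem_map] at this
    obtain ⟨e, he, h2⟩ := this
    exact Set.mem_biUnion he h2
  rcases hG.finite_or_finite_compl hbd with hA | hA
  · refine hu (hA.subset fun g hg => ?_)
    rw [Set.mem_ofPred_eq, mem_stabilizer_iff.1 hg]
    exact mem_halfTree_self
  -- An element fixing `v` but not `u` sends `u` to another neighbor of `v`, on the `v` side.
  · refine hv ((hfin.union hA).subset fun g hg => ?_)
    by_cases hgu : g • u = u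
    · exact .inl ⟨hgu, hg⟩
    refine .inr fun hmem => hT.notMem_halfTree h (mem_halfTree_of_adj hmem
      (y := v) ?_ fun he => ?_)
    · simpa [mem_stabilizer_iff.1 hg] using hact g u v h
    · rcases Sym2.eq_iff.1 he with h1 | h1
      · exact hgu h1.1
      · exact h.ne h1.2.symm

end Edge

/-! ### The quotient by equality of stabilizers. -/

section Quotient

variable (G : Type*) [Group G] (V : Type*) [MulAction G V]

/-- The quotient identifying points with equal stabilizers. -/
abbrev StabilizerQuotient : Type _ := Quotient (Setoid.ker (stabilizer G : V → Subgroup G))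

variable {G V}

theorem MulAction.stabilizer_smul_eq_iff {g : G} {u v : V} :
    stabilizer G (g • u) = stabilizer G (g • v) ↔ stabilizer G u = stabilizer G v := by
  simp only [stabilizer_smul_eq_stabilizer_map_conj]
  exact (Subgroup.map_injective (MulAut.conj g).injective).eq_iff

namespace StabilizerQuotient

instance : MulAction G (StabilizerQuotient G V) where
  smul g := Quotient.map (g • ·) fun _ _ h => stabilizer_smul_eq_iff.2 h
  one_smul := by
    refine Quotient.ind fun v => congrArg (Quotient.mk _) (one_smul G v)
  mul_smul a b := by
    refine Quotient.ind fun v => congrArg (Quotient.mk _) (mul_smul a b v)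

variable (G) in
/-- The class of a point. -/
def mk (v : V) : StabilizerQuotient G V := Quotient.mk _ v

theorem mk_surjective : Function.Surjective (mk G : V → StabilizerQuotient G V) :=
  Quotient.mk_surjective

theorem smul_mk (g : G) (v : V) : g • mk G v = mk G (g • v) := rfl

theorem mk_eq_mk {u v : V} : mk G u = mk G v ↔ stabilizer G u = stabilizer G v := Quotient.eq

/-- An element fixing the class normalizes the stabilizer of `v`, hence lies in its commensurator.
-/
theorem stabilizer_mk {v : V} (hv : IsFull (stabilizer G v)) :
    stabilizer G (mk G v) = stabilizer G v := by
  ext g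
  rw [mem_stabilizer_iff, smul_mk, mk_eq_mk]
  constructor
  · intro h
    rw [stabilizer_smul_eq_stabilizer_map_conj] at h
    exact hv.mem_of_conj_eq h
  · intro h
    rw [mem_stabilizer_iff.1 h]

variable (G) in
/-- The image of a graph in the quotient, without loops. -/
def graph (T : SimpleGraph V) : SimpleGraph (StabilizerQuotient G V) where
  Adj x y := x ≠ y ∧ ∃ u v, T.Adj u v ∧ mk G u = x ∧ mk G v = y
  symm := ⟨fun _ _ ⟨h, u, v, huv, hu, hv⟩ => ⟨h.symm, v, u, huv.symm, hv, hu⟩⟩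
  loopless := ⟨fun _ h => h.1 rfl⟩

theorem isSimplicialAction_graph {T : SimpleGraph V} (hact : IsSimplicialAction G T) :
    IsSimplicialAction G (graph G T) := by
  rintro g _ _ ⟨hne, u, v, h, rfl, rfl⟩
  exact ⟨fun he => hne (MulAction.injective g he), g • u, g • v, hact g u v h, rfl, rfl⟩

end StabilizerQuotient

end Quotient

/-! ### The quotient is a tree. -/

namespace IsElementaryBipartite

variable {G : Type*} [Group G] {V : Type*} [MulAction G V] {T : SimpleGraph V} {u v w : V}

theorem mem_elementaryVertices (hbip : IsElementaryBipartite G T) (h : T.Adj u v)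
    (hu : u ∈ nonelementaryVertices G V) : v ∈ elementaryVertices G V := by
  rcases hbip.mem_of_adj h with h1 | h1
  · exact absurd h1.1 hu
  · exact h1.2

theorem stabilizer_ne (hbip : IsElementaryBipartite G T) (h : T.Adj u v) :
    stabilizer G u ≠ stabilizer G v := by
  intro he
  rcases hbip.mem_of_adj h with h1 | h1
  · exact h1.2 (by rw [← he]; exact h1.1)
  · exact h1.1 (by rw [he]; exact h1.2)

/-- The projection of the graph to its stabilizer quotient. -/
def proj (hbip : IsElementaryBipartite G T) : T →g StabilizerQuotient.graph G T where
  toFun := StabilizerQuotient.mk G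
  map_rel' h := ⟨fun he => hbip.stabilizer_ne h (StabilizerQuotient.mk_eq_mk.1 he), _, _, h, rfl, rfl⟩

/-- Otherwise the common stabilizer fixes the path from `u` to `w`, in particular an elementary
neighbor of `u`, and so is elementary. -/
theorem eq_of_stabilizer_eq (hbip : IsElementaryBipartite G T) (hact : IsSimplicialAction G T)
    (hT : T.IsTree) (hu : u ∈ nonelementaryVertices G V)
    (h : stabilizer G u = stabilizer G w) : u = w := by
  by_contra hne
  obtain ⟨p, hp⟩ := (hT.existsUnique_path u w).exists
  obtain ⟨x, hx, hux, -⟩ := hp.exists_mem_halfTree hne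
  have hle := hact.inf_stabilizer_le hT hp hx
  rw [← h, inf_idem] at hle
  exact hu ((hbip.mem_elementaryVertices hux hu).mono hle)

/-- If the stabilizers of an elementary vertex `u` and a nonelementary vertex `v` meet in an
infinite group, the first edge from `v` towards `u` leads to a vertex equivalent to `u`. -/
theorem exists_adj_of_infinite (hbip : IsElementaryBipartite G T) (hact : IsSimplicialAction G T)
    (hT : T.IsTree) (hfull : ∀ v : V, IsFull (stabilizer G v))
    (hu : u ∈ elementaryVertices G V) (hv : v ∈ nonelementaryVertices G V)
    (h : ((stabilizer G u ⊓ stabilizer G v : Subgroup G) : Set G).Infinite) :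
    ∃ x, T.Adj v x ∧ stabilizer G x = stabilizer G u ∧ u ∈ T.halfTree x v := by
  obtain ⟨p, hp⟩ := (hT.existsUnique_path v u).exists
  obtain ⟨x, hx, hvx, hux⟩ := hp.exists_mem_halfTree (by rintro rfl; exact hv hu)
  have hle := hact.inf_stabilizer_le hT hp hx
  refine ⟨x, hvx, ?_, hux⟩
  refine (hbip.mem_elementaryVertices hvx hv).eq_of_infinite_inf hu (hfull _) (hfull _)
    (h.mono ?_)
  exact fun g hg => ⟨hle ⟨hg.2, hg.1⟩, hg.1⟩

/-- The set `A` of vertices seen from `v` through a neighbor equivalent to `u` is a union of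
classes, and the only edges leaving it map to the edge in question; `v` lies outside. -/
theorem isBridge_graph (hbip : IsElementaryBipartite G T) (hact : IsSimplicialAction G T)
    (hT : T.IsTree) (hfull : ∀ v : V, IsFull (stabilizer G v))
    (hinf : ∀ v : V, (stabilizer G v : Set G).Infinite)
    (hedge : ∀ ⦃u v : V⦄, T.Adj u v →
      ((stabilizer G u ⊓ stabilizer G v : Subgroup G) : Set G).Infinite)
    (huv : T.Adj u v) (hu : u ∈ elementaryVertices G V) (hv : v ∈ nonelementaryVertices G V) :
    (StabilizerQuotient.graph G T).IsBridge
      s(StabilizerQuotient.mk G u, StabilizerQuotient.mk G v) := by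
  let A : Set V := {w | ∃ x, T.Adj v x ∧ stabilizer G x = stabilizer G u ∧ w ∈ T.halfTree x v}
  -- If `b` is outside the half-tree of `a`, the path from `a` to `b` passes through `x`, so their
  -- common stabilizer lies in that of `u` and equals it. The path from `v` to `b` then also starts
  -- at a neighbor equivalent to `u`.
  have hsat : ∀ {a b : V}, stabilizer G a = stabilizer G b → a ∈ A → b ∈ A := by
    intro a b hab ⟨x, hvx, hxu, hax⟩
    by_cases hbx : b ∈ T.halfTree x v
    · exact ⟨x, hvx, hxu, hbx⟩
    have hle := hact.inf_stabilizer_le_of_mem_halfTree hT hax hbx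
    rw [hab, inf_idem, hxu] at hle
    have hbe : b ∈ elementaryVertices G V := IsElementary.mono hu hle
    have hbu : stabilizer G b = stabilizer G u :=
      IsElementary.eq_of_infinite_inf hbe hu (hfull _) (hfull _)
        (by rw [inf_eq_left.2 hle]; exact hinf b)
    obtain ⟨y, hvy, hyb, hby⟩ := hbip.exists_adj_of_infinite hact hT hfull hbe hv
      (by rw [hbu]; exact hedge huv)
    exact ⟨y, hvy, hyb.trans hbu, hby⟩
  -- Lift a walk edge by edge: saturation allows moving to the representative `a` at which the next
  -- edge lifts, and leaving the half-tree would cross an edge above the deleted one.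
  have hreach : ∀ q, ((StabilizerQuotient.graph G T).deleteEdges
      {s(StabilizerQuotient.mk G u, StabilizerQuotient.mk G v)}).Reachable
        (StabilizerQuotient.mk G u) q → ∃ w ∈ A, StabilizerQuotient.mk G w = q := by
    intro q hq
    rw [reachable_iff_reflTransGen] at hq
    induction hq with
    | refl => exact ⟨u, ⟨u, huv.symm, rfl, mem_halfTree_self⟩, rfl⟩
    | tail _ hadj ih =>
      obtain ⟨w, hw, rfl⟩ := ih
      obtain ⟨⟨-, a, b, hab, haw, rfl⟩, hne⟩ := deleteEdges_adj.1 hadj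
      obtain ⟨x, hvx, hxu, hax⟩ := hsat (StabilizerQuotient.mk_eq_mk.1 haw.symm) hw
      refine ⟨b, ⟨x, hvx, hxu, mem_halfTree_of_adj hax hab fun he => hne ?_⟩, rfl⟩
      have := congrArg (Sym2.map (StabilizerQuotient.mk G)) he
      rw [Sym2.map_mk, Sym2.map_mk, haw, StabilizerQuotient.mk_eq_mk.2 hxu] at this
      exact this
  rw [isBridge_iff]
  intro h
  obtain ⟨w, ⟨x, hvx, -, hwx⟩, hwv⟩ := hreach _ h
  -- The vertex `v` is alone in its class, so `w = v`, which is not beyond `x`.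
  rw [← hbip.eq_of_stabilizer_eq hact hT hv (StabilizerQuotient.mk_eq_mk.1 hwv.symm)] at hwx
  exact hT.notMem_halfTree hvx.symm hwx

theorem isTree_graph (hbip : IsElementaryBipartite G T) (hact : IsSimplicialAction G T)
    (hT : T.IsTree) (hfull : ∀ v : V, IsFull (stabilizer G v))
    (hinf : ∀ v : V, (stabilizer G v : Set G).Infinite)
    (hedge : ∀ ⦃u v : V⦄, T.Adj u v →
      ((stabilizer G u ⊓ stabilizer G v : Subgroup G) : Set G).Infinite) :
    (StabilizerQuotient.graph G T).IsTree := by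
  refine ⟨hT.connected.map hbip.proj StabilizerQuotient.mk_surjective, ?_⟩
  rw [isAcyclic_iff_forall_adj_isBridge]
  rintro _ _ ⟨-, u, v, h, rfl, rfl⟩
  rcases hbip.mem_of_adj h with h1 | h1
  · exact hbip.isBridge_graph hact hT hfull hinf hedge h h1.1 h1.2
  · rw [Sym2.eq_swap]
    exact hbip.isBridge_graph hact hT hfull hinf hedge h.symm h1.2 h1.1

end IsElementaryBipartite

theorem propositionp {G : Type u} [Group G]
    (hG : IsHyperbolicGroup G) (hG1 : IsOneEndedGroup G)
    {V : Type v} [MulAction G V] (T : SimpleGraph V) (hT : T.IsTree)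
    (hact : IsSimplicialAction G T) (hbip : IsElementaryBipartite G T)
    (hfull : ∀ v : V, IsFull (MulAction.stabilizer G v)) :
    -- the tree `T'`, the graph map `f : T → T'`, and the induced action on `T'`
    ∃ (V' : Type v) (_ : MulAction G V') (T' : SimpleGraph V') (f : T →g T'),
      T'.IsTree ∧ IsSimplicialAction G T' ∧
      (∀ (g : G) (v : V), f (g • v) = g • f v) ∧
      -- `f` is surjective on vertices and on edges
      Function.Surjective f ∧
      (∀ x y : V', T'.Adj x y → ∃ u v : V, T.Adj u v ∧ f u = x ∧ f v = y) ∧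
      -- `f` identifies exactly the vertices with equal stabilizers
      (∀ u v : V, f u = f v ↔ MulAction.stabilizer G u = MulAction.stabilizer G v) ∧
      -- an elementary and a nonelementary class are joined iff their stabilizers meet in an
      -- infinite group
      (∀ u ∈ elementaryVertices G V, ∀ v ∈ nonelementaryVertices G V,
        T'.Adj (f u) (f v) ↔
          ((MulAction.stabilizer G u ⊓ MulAction.stabilizer G v : Subgroup G) : Set G).Infinite) ∧
      HasDistinctStabilizers G V' ∧
      IsElementaryBipartite G T' ∧
      (∀ v : V, MulAction.stabilizer G (f v) = MulAction.stabilizer G v) := by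

  have := hG1.infinite
  have hinf : ∀ v : V, (stabilizer G v : Set G).Infinite := fun v => (hfull v).infinite
  have hedge : ∀ ⦃u v : V⦄, T.Adj u v →
      ((stabilizer G u ⊓ stabilizer G v : Subgroup G) : Set G).Infinite :=
    fun u v h => hG1.infinite_inf_stabilizer hact hT h (hinf u) (hinf v)
  have hstab : ∀ v : V, stabilizer G (StabilizerQuotient.mk G v) = stabilizer G v :=
    fun v => StabilizerQuotient.stabilizer_mk (hfull v)
  refine ⟨StabilizerQuotient G V, inferInstance, StabilizerQuotient.graph G T, hbip.proj,
    hbip.isTree_graph hact hT hfull hinf hedge, StabilizerQuotient.isSimplicialAction_graph hact,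
    fun _ _ => rfl, StabilizerQuotient.mk_surjective, fun x y h => h.2,
    fun u v => StabilizerQuotient.mk_eq_mk, fun u hu v hv => ⟨?_, fun h => ?_⟩, ?_, ⟨?_, ?_⟩, hstab⟩
  · rintro ⟨-, a, b, hab, ha, hb⟩
    rw [← StabilizerQuotient.mk_eq_mk.1 ha, ← StabilizerQuotient.mk_eq_mk.1 hb]
    exact hedge hab
  -- `u` itself need not be adjacent to `v`; an equivalent vertex `x` is.
  · obtain ⟨x, hvx, hxu, -⟩ := hbip.exists_adj_of_infinite hact hT hfull hu hv h
    have h1 := hbip.proj.map_adj hvx.symm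
    rwa [show hbip.proj x = hbip.proj u from StabilizerQuotient.mk_eq_mk.2 hxu] at h1
  · intro x y hxy he
    obtain ⟨u, rfl⟩ := StabilizerQuotient.mk_surjective x
    obtain ⟨v, rfl⟩ := StabilizerQuotient.mk_surjective y
    rw [hstab, hstab] at he
    exact hxy (StabilizerQuotient.mk_eq_mk.2 he)
  · exact Set.disjoint_left.2 fun x h1 h2 => h2 h1
  · rintro _ _ ⟨-, u, v, h, rfl, rfl⟩
    simpa only [elementaryVertices, nonelementaryVertices, Set.mem_ofPred_eq, hstab] using
      hbip.mem_of_adj h
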